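/- Let $k,l\ge 0$ be integers, $n=k+l$, $\tau_i=1$ for $i\le k$ and $\tau_i=-1$ for $k<i\le n$, and $\langle x,y\rangle=\sum_i\tau_ix_iy_i$ on $\mathbb R^n$. Let $J=\mathrm{diag}(J_1,\dots,J_n)$ be real with $J_i\neq 0$ and $J_i^2\ne J_j^2$ for $i\neq j$, and let $c\in\{1,-1,0\}$. Put $\phi_1=\langle q,q\rangle$, $\phi_2=\langle Q,Q\rangle$, $$P_c^*=\{(q,Q)\in\mathbb R^n\times\mathbb R^n : \langle q,q\rangle=\langle Q,Q\rangle=c,\ \langle q,J^{-1}Q\rangle\neq0\},\qquad \Omega=\sum_i\tau_iJ_i\,dQ_i\wedge dq_i .$$ Let $\{f,g\}=\sum_i\frac{\tau_i}{J_i}\left(\frac{\partial f}{\partial q_i}\frac{\partial g}{\partial Q_i}-\frac{\partial f}{\partial Q_i}\frac{\partial g}{\partial q_i}\right)$ be the Poisson bracket of $\Omega$ on $\mathbb R^{2n}$, and let $$\{f,g\}^D=\{f,g\}-\frac{\{\phi_1,f\}\{\phi_2,g\}-\{\phi_2,f\}\{\phi_1,g\}}{\{\phi_1,\phi_2\}}$$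 be the Dirac bracket. The Heisenberg map is $$\Phi(q,Q)=(Q,\ \lambda J^{-1}Q-q),\qquad \lambda=\frac{2\langle J^{-1}Q,q\rangle}{\langle J^{-2}Q,Q\rangle},$$ defined where $\langle J^{-2}Q,Q\rangle\ne0$. Put $$f_i(q,Q)=c\,\tau_iq_i^2+\sum_{j\ne i}\frac{\tau_i\tau_j(J_jQ_jq_i-q_jJ_iQ_i)^2}{J_i^2-J_j^2},\qquad i=1,\dots,n.$$ Theorem. The Heisenberg model is a completely integrable discrete Hamiltonian system on $(P_c^*,\Omega)$, that is: 1. $d\phi_1,d\phi_2$ are linearly independent at every point of $P_c^*$, so that $P_c^*$ is a submanifold of dimension $2(n-1)$, and $\Omega$ is nondegenerate on its tangent spaces. The Dirac bracket is the Poisson bracket of $(P_c^*,\Omega)$: at every $x\in P_c^*$ and for all $f,g$ differentiable at $x$, $\{f,g\}^D=df(X_g)$, where $X_g\in T_xP_c^*$ satisfies $\Omega(X_g,v)=-dg(v)$ for all $v\in T_xP_c^*$. 2. At every point of $P_c^*$ with $\langle J^{-2}Q,Q\rangle\ne0$, $\Phi$ is smooth, takes its value in $P_c^*$, and satisfies $\Phi^*\Omega=\Omega$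 on the tangent space of $P_c^*$. 3. The $f_i$ are the integrals obtained from the Lax matrix $L(z)=J^2+z\,Fq\wedge FJQ-z^2c\,Fq\otimes Fq$, where $F=\mathrm{diag}(1,\dots,1,\sqrt{-1},\dots,\sqrt{-1})$ with $k$ entries $1$, and $a\wedge b=a\otimes b-b\otimes a$: on $P_c^*$, for all $z,\mu\in\mathbb C$, $$\det(\mu-L(z))=\prod_i(\mu-J_i^2)+z^2\sum_if_i\prod_{j\ne i}(\mu-J_j^2).$$ They are preserved: $f_i\circ\Phi=f_i$ at every point of $P_c^*$ with $\langle J^{-2}Q,Q\rangle\ne0$. 4. $\{f_i,f_j\}^D=0$ on $P_c^*$ for all $i,j$. 5. On $P_c^*$ one has $\sum_if_i=c^2$, and this is the only relation: on an open dense subset of $P_c^*$, the only linear relations among the restrictions of $df_1,\dots,df_n$ to the tangent space of $P_c^*$ are the multiples of $\sum_idf_i=0$; in particular exactly $n-1=\tfrac12\dim P_c^*$ of the $f_i$ are independent there. -/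

import Mathlib

/-- Phase space `E^{k,l} × E^{k,l}`; a point is a pair `(q, Q)`. -/
abbrev Phase (k l : ℕ) : Type := (Fin (k + l) → ℝ) × (Fin (k + l) → ℝ)

/-- The signs `τ_i` of the pseudo-Euclidean metric: `k` times `1`, then `l` times `-1`. -/
def tau (k l : ℕ) (i : Fin (k + l)) : ℝ := if i.val < k then 1 else -1

/-- The pseudo-Euclidean scalar product of signature `(k, l)`. -/
def pseudoInner (k l : ℕ) (x y : Fin (k + l) → ℝ) : ℝ := ∑ i, tau k l i * x i * y i

/-- `φ₁ (q, Q) = ⟨q, q⟩`. -/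
def phiOne (k l : ℕ) (x : Phase k l) : ℝ := pseudoInner k l x.1 x.1

/-- `φ₂ (q, Q) = ⟨Q, Q⟩`. -/
def phiTwo (k l : ℕ) (x : Phase k l) : ℝ := pseudoInner k l x.2 x.2

/-- `K (q, Q) = ⟨J⁻¹ Q, q⟩`. -/
noncomputable def kFun (k l : ℕ) (J : Fin (k + l) → ℝ) (x : Phase k l) : ℝ :=
  pseudoInner k l (fun i => (J i)⁻¹ * x.2 i) x.1

/-- `⟨J⁻² Q, Q⟩`; the dynamics is defined where this does not vanish. -/
noncomputable def singFun (k l : ℕ) (J : Fin (k + l) → ℝ) (x : Phase k l) : ℝ :=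
  pseudoInner k l (fun i => (J i ^ 2)⁻¹ * x.2 i) x.2

/-- `P_c^* = {(q, Q) | ⟨q, q⟩ = ⟨Q, Q⟩ = c, ⟨q, J⁻¹ Q⟩ ≠ 0}`. -/
def PStar (k l : ℕ) (c : ℝ) (J : Fin (k + l) → ℝ) : Set (Phase k l) :=
  {x | phiOne k l x = c ∧ phiTwo k l x = c ∧ kFun k l J x ≠ 0}

/-- The part of `P_c^*` on which the map of the Heisenberg model is defined. -/
def PStarDom (k l : ℕ) (c : ℝ) (J : Fin (k + l) → ℝ) : Set (Phase k l) :=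
  {x | x ∈ PStar k l c J ∧ singFun k l J x ≠ 0}

/-- The multiplier `2 ⟨J⁻¹ Q, q⟩ / ⟨J⁻² Q, Q⟩`. -/
noncomputable def multiplier (k l : ℕ) (J : Fin (k + l) → ℝ) (x : Phase k l) : ℝ :=
  2 * kFun k l J x / singFun k l J x

/-- The Heisenberg map `(q_{k-1}, q_k) ↦ (q_k, q_{k+1})`, where
`q_{k+1} + q_{k-1} = λ_k J⁻¹ q_k`. -/
noncomputable def heisenbergMap (k l : ℕ) (J : Fin (k + l) → ℝ) (x : Phase k l) : Phase k l :=
  (x.2, fun i => multiplier k l J x * (J i)⁻¹ * x.2 i - x.1 i)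

/-- The tangent space at `x` of the level set of `(φ₁, φ₂)` through `x`. -/
noncomputable def tangentSpaceP (k l : ℕ) (x : Phase k l) : Submodule ℝ (Phase k l) :=
  LinearMap.ker (fderiv ℝ (phiOne k l) x).toLinearMap ⊓
    LinearMap.ker (fderiv ℝ (phiTwo k l) x).toLinearMap

/-- The constant 2-form `Ω = ∑ i, τ_i J_i dQ_i ∧ dq_i`. -/
def Omega (k l : ℕ) (J : Fin (k + l) → ℝ) (u v : Phase k l) : ℝ :=
  ∑ i, tau k l i * J i * (u.2 i * v.1 i - u.1 i * v.2 i)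

/-- `∂f/∂q_i`. -/
noncomputable def dq (k l : ℕ) (f : Phase k l → ℝ) (i : Fin (k + l)) (x : Phase k l) : ℝ :=
  fderiv ℝ f x (Pi.single i 1, 0)

/-- `∂f/∂Q_i`. -/
noncomputable def dQ (k l : ℕ) (f : Phase k l → ℝ) (i : Fin (k + l)) (x : Phase k l) : ℝ :=
  fderiv ℝ f x (0, Pi.single i 1)

/-- The Poisson bracket of `Ω` on the whole phase space
(`τ_i / J_i` are the diagonal entries of `E J⁻¹`). -/
noncomputable def poisson (k l : ℕ) (J : Fin (k + l) → ℝ) (f g : Phase k l → ℝ)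
    (x : Phase k l) : ℝ :=
  ∑ i, tau k l i / J i * (dq k l f i x * dQ k l g i x - dQ k l f i x * dq k l g i x)

/-- The Dirac bracket for the constraints `φ₁`, `φ₂`. -/
noncomputable def diracBracket (k l : ℕ) (J : Fin (k + l) → ℝ) (f g : Phase k l → ℝ)
    (x : Phase k l) : ℝ :=
  poisson k l J f g x -
    (poisson k l J (phiOne k l) f x * poisson k l J (phiTwo k l) g x -
      poisson k l J (phiTwo k l) f x * poisson k l J (phiOne k l) g x) /
      poisson k l J (phiOne k l) (phiTwo k l) x

/-- The integrals `f_i`. -/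
noncomputable def heisenbergIntegral (k l : ℕ) (c : ℝ) (J : Fin (k + l) → ℝ) (i : Fin (k + l))
    (x : Phase k l) : ℝ :=
  c * tau k l i * x.1 i ^ 2 +
    ∑ j ∈ Finset.univ.erase i, tau k l i * tau k l j *
      (J j * x.2 j * x.1 i - x.1 j * J i * x.2 i) ^ 2 / (J i ^ 2 - J j ^ 2)

/-- The diagonal entries of `F = diag(1, …, 1, i, …, i)`. -/
noncomputable def Fdiag (k l : ℕ) (i : Fin (k + l)) : ℂ := if i.val < k then 1 else Complex.I

/-- The Lax matrix `L(z) = J² + z Fq ∧ FJQ - z² c Fq ⊗ Fq`,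
where `a ∧ b = a ⊗ b - b ⊗ a`. -/
noncomputable def laxMatrix (k l : ℕ) (c : ℝ) (J : Fin (k + l) → ℝ) (x : Phase k l) (z : ℂ) :
    Matrix (Fin (k + l)) (Fin (k + l)) ℂ :=
  let a : Fin (k + l) → ℂ := fun i => Fdiag k l i * (x.1 i : ℂ)
  let b : Fin (k + l) → ℂ := fun i => Fdiag k l i * ((J i * x.2 i : ℝ) : ℂ)
  Matrix.diagonal (fun i => ((J i ^ 2 : ℝ) : ℂ)) +
    z • (Matrix.vecMulVec a b - Matrix.vecMulVec b a) -
    (z ^ 2 * (c : ℂ)) • Matrix.vecMulVec a a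

/-- The points of `P_c^*` at which the only linear relations among the differentials of
`f_1, …, f_n` on the tangent space of `P_c^*` are the multiples of `∑ i, df_i = 0`. -/
def regularSet (k l : ℕ) (c : ℝ) (J : Fin (k + l) → ℝ) : Set (Phase k l) :=
  {x | x ∈ PStar k l c J ∧ ∀ a : Fin (k + l) → ℝ,
    (∀ u ∈ tangentSpaceP k l x, ∑ i, a i * fderiv ℝ (heisenbergIntegral k l c J i) x u = 0) →
      ∀ i j, a i = a j}

/-! ### Linear algebra and calculus of the constraints. -/

section Prelim
variable {k l : ℕ}

/-! Write `K = ⟨J⁻¹Q, q⟩` and `p = JQ`. The vectors `normalOne` and `normalTwo` span the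
`Ω`-orthogonal complement of the tangent space, and the differentials of the constraints take on
them the values `2K` times the identity matrix. Thus `K ≠ 0` makes this complement transversal to
the tangent space. Independence of the constraints, the dimension, nondegeneracy and the formula for
the Dirac bracket (`diracBracket_eq_fderiv`) all come from the projection `tangentProj` along it.

The multiplier is the value for which `⟨Q, Q⟩` after the step equals `⟨q, q⟩` before it. In the
pullback of `Ω` its differential appears only beside `⟨Q, dQ⟩`, which vanishes on tangent vectors.

The integrals depend on `Q` only through `q ∧ p`. In the step the multiplier cancels from this
bivector, which gives conservation. The translation `p ↦ p + sq` leaves the bivector fixed, so `φ₁`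
Poisson-commutes with every `f_i` and the Dirac correction drops out. Involution then holds already
on the whole phase space, by the three-term partial fraction identity in `momentCoeff_identity`. The
Lax matrix is a perturbation of `J²` of rank at most two, so its characteristic polynomial is a 2 ×
2 determinant, expanded by a Lagrange identity in partial fractions (`sum_mul_sum_sub_sq`).

For independence, the `Q`-derivatives turn a relation among the `df_i` into a Laplacian-type linear
system with weights `momentCoeff`. Moving `Q` in a coordinate direction adds a star-shaped weight,
and the system then has only constant solutions unless the parameter is an eigenvalue of a fixed
endomorphism. Corrections along the constraints keep the perturbed points in `P_c^*`, which yields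
density. Openness is openness of linear independence. -/

theorem tau_mul_self (i : Fin (k + l)) : tau k l i * tau k l i = 1 := by
  unfold tau; split_ifs <;> norm_num

theorem tau_sq (i : Fin (k + l)) : tau k l i ^ 2 = 1 := by
  rw [sq, tau_mul_self]

theorem tau_ne_zero (i : Fin (k + l)) : tau k l i ≠ 0 := by
  unfold tau; split_ifs <;> norm_num

theorem fderiv_apply_eq_of_hasDerivAt {E F : Type*} [NormedAddCommGroup E] [NormedSpace ℝ E]
    [NormedAddCommGroup F] [NormedSpace ℝ F] {f : E → F} {x u : E} {d : F}
    (hf : DifferentiableAt ℝ f x) (h : HasDerivAt (fun t : ℝ => f (x + t • u)) d 0) :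
    fderiv ℝ f x u = d :=
  (hf.hasFDerivAt.hasLineDerivAt u).unique h

theorem contDiff_pseudoInner {E : Type*} [NormedAddCommGroup E] [NormedSpace ℝ E]
    {n : WithTop ℕ∞} {a b : E → Fin (k + l) → ℝ} (ha : ContDiff ℝ n a) (hb : ContDiff ℝ n b) :
    ContDiff ℝ n fun x => pseudoInner k l (a x) (b x) := by
  unfold pseudoInner
  rw [contDiff_pi] at ha hb
  exact ContDiff.sum fun i _ => (contDiff_const.mul (ha i)).mul (hb i)

theorem contDiff_phiOne {n : WithTop ℕ∞} : ContDiff ℝ n (phiOne k l) :=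
  contDiff_pseudoInner contDiff_fst contDiff_fst

theorem contDiff_phiTwo {n : WithTop ℕ∞} : ContDiff ℝ n (phiTwo k l) :=
  contDiff_pseudoInner contDiff_snd contDiff_snd

theorem contDiff_snd_apply {n : WithTop ℕ∞} (i : Fin (k + l)) :
    ContDiff ℝ n fun x : Phase k l => x.2 i :=
  (contDiff_apply ℝ ℝ i).comp contDiff_snd

theorem contDiff_fst_apply {n : WithTop ℕ∞} (i : Fin (k + l)) :
    ContDiff ℝ n fun x : Phase k l => x.1 i :=
  (contDiff_apply ℝ ℝ i).comp contDiff_fst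

theorem contDiff_kFun {n : WithTop ℕ∞} (J : Fin (k + l) → ℝ) : ContDiff ℝ n (kFun k l J) :=
  contDiff_pseudoInner (contDiff_pi.2 fun i => contDiff_const.mul (contDiff_snd_apply i))
    contDiff_fst

theorem contDiff_singFun {n : WithTop ℕ∞} (J : Fin (k + l) → ℝ) : ContDiff ℝ n (singFun k l J) :=
  contDiff_pseudoInner (contDiff_pi.2 fun i => contDiff_const.mul (contDiff_snd_apply i))
    contDiff_snd

theorem contDiff_heisenbergIntegral {n : WithTop ℕ∞} (c : ℝ) (J : Fin (k + l) → ℝ)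
    (i : Fin (k + l)) : ContDiff ℝ n (heisenbergIntegral k l c J i) := by
  unfold heisenbergIntegral
  have h1 := fun i => contDiff_fst_apply (k := k) (l := l) (n := n) i
  have h2 := fun i => contDiff_snd_apply (k := k) (l := l) (n := n) i
  refine ((contDiff_const.mul ((h1 i).pow 2))).add (ContDiff.sum fun j _ => ?_)
  refine ContDiff.div_const (contDiff_const.mul (ContDiff.pow ?_ 2)) _
  exact ((contDiff_const.mul (h2 j)).mul (h1 i)).sub (((h1 j).mul contDiff_const).mul (h2 i))

theorem hasDerivAt_line (a b : ℝ) : HasDerivAt (fun t : ℝ => a + t * b) b 0 := by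
  simpa using ((hasDerivAt_id (0 : ℝ)).mul_const b).const_add a

theorem fderiv_phiOne (x u : Phase k l) :
    fderiv ℝ (phiOne k l) x u = 2 * pseudoInner k l x.1 u.1 := by
  refine fderiv_apply_eq_of_hasDerivAt
    ((contDiff_phiOne (n := 1)).differentiable (by norm_num) x) ?_
  unfold phiOne pseudoInner
  rw [Finset.mul_sum]
  refine HasDerivAt.fun_sum fun i _ => ?_
  have h := hasDerivAt_line (x.1 i) (u.1 i)
  exact ((h.const_mul (tau k l i)).mul h).congr_deriv (by ring)

theorem fderiv_phiTwo (x u : Phase k l) :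
    fderiv ℝ (phiTwo k l) x u = 2 * pseudoInner k l x.2 u.2 := by
  refine fderiv_apply_eq_of_hasDerivAt
    ((contDiff_phiTwo (n := 1)).differentiable (by norm_num) x) ?_
  unfold phiTwo pseudoInner
  rw [Finset.mul_sum]
  refine HasDerivAt.fun_sum fun i _ => ?_
  have h := hasDerivAt_line (x.2 i) (u.2 i)
  exact ((h.const_mul (tau k l i)).mul h).congr_deriv (by ring)

theorem mem_tangentSpaceP {x u : Phase k l} :
    u ∈ tangentSpaceP k l x ↔ pseudoInner k l x.1 u.1 = 0 ∧ pseudoInner k l x.2 u.2 = 0 := by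
  simp [tangentSpaceP, fderiv_phiOne, fderiv_phiTwo]

theorem pseudoInner_comm (a b : Fin (k + l) → ℝ) : pseudoInner k l a b = pseudoInner k l b a := by
  unfold pseudoInner
  exact Finset.sum_congr rfl fun i _ => by ring

theorem pseudoInner_single (a : Fin (k + l) → ℝ) (i : Fin (k + l)) (r : ℝ) :
    pseudoInner k l a (Pi.single i r) = tau k l i * a i * r := by
  unfold pseudoInner
  rw [Finset.sum_eq_single i] <;> simp +contextual

theorem pseudoInner_smul_right (a b : Fin (k + l) → ℝ) (r : ℝ) :
    pseudoInner k l a (r • b) = r * pseudoInner k l a b := by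
  simp only [pseudoInner, Finset.mul_sum, Pi.smul_apply, smul_eq_mul]
  exact Finset.sum_congr rfl fun i _ => by ring

theorem pseudoInner_sub_right (a b b' : Fin (k + l) → ℝ) :
    pseudoInner k l a (b - b') = pseudoInner k l a b - pseudoInner k l a b' := by
  simp [pseudoInner, mul_sub, Finset.sum_sub_distrib]

theorem pseudoInner_zero_right (a : Fin (k + l) → ℝ) : pseudoInner k l a 0 = 0 := by
  simp [pseudoInner]

/-! ### The `Ω`-orthogonal splitting and the Dirac bracket. -/

/-- The vector `(J⁻¹ Q, 0)`; it is `Ω`-orthogonal to the kernel of `dφ₂`. -/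
noncomputable def normalOne (J : Fin (k + l) → ℝ) (x : Phase k l) : Phase k l :=
  (fun i => (J i)⁻¹ * x.2 i, 0)

/-- The vector `(0, J⁻¹ q)`; it is `Ω`-orthogonal to the kernel of `dφ₁`. -/
noncomputable def normalTwo (J : Fin (k + l) → ℝ) (x : Phase k l) : Phase k l :=
  (0, fun i => (J i)⁻¹ * x.1 i)

theorem pseudoInner_normalOne (J : Fin (k + l) → ℝ) (x : Phase k l) :
    pseudoInner k l x.1 (normalOne J x).1 = kFun k l J x := pseudoInner_comm _ _

theorem pseudoInner_normalTwo (J : Fin (k + l) → ℝ) (x : Phase k l) :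
    pseudoInner k l x.2 (normalTwo J x).2 = kFun k l J x := by
  simp only [pseudoInner, normalTwo, kFun]
  exact Finset.sum_congr rfl fun i _ => by ring

theorem Omega_normalOne {J : Fin (k + l) → ℝ} (hJ : ∀ i, J i ≠ 0) (x v : Phase k l) :
    Omega k l J (normalOne J x) v = -pseudoInner k l x.2 v.2 := by
  simp only [pseudoInner, normalOne, Omega, ← Finset.sum_neg_distrib]
  refine Finset.sum_congr rfl fun i _ => ?_
  have := hJ i
  simp only [Pi.zero_apply]
  field_simp
  ring

theorem Omega_normalTwo {J : Fin (k + l) → ℝ} (hJ : ∀ i, J i ≠ 0) (x v : Phase k l) :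
    Omega k l J (normalTwo J x) v = pseudoInner k l x.1 v.1 := by
  simp only [pseudoInner, normalTwo, Omega]
  refine Finset.sum_congr rfl fun i _ => ?_
  have := hJ i
  simp only [Pi.zero_apply]
  field_simp
  ring

theorem Omega_antisymm (J : Fin (k + l) → ℝ) (u v : Phase k l) :
    Omega k l J u v = -Omega k l J v u := by
  simp only [Omega, ← Finset.sum_neg_distrib]
  exact Finset.sum_congr rfl fun i _ => by ring

theorem Omega_add_left (J : Fin (k + l) → ℝ) (u u' v : Phase k l) :
    Omega k l J (u + u') v = Omega k l J u v + Omega k l J u' v := by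
  simp only [Omega, ← Finset.sum_add_distrib, Prod.fst_add, Prod.snd_add, Pi.add_apply]
  exact Finset.sum_congr rfl fun i _ => by ring

theorem Omega_smul_left (J : Fin (k + l) → ℝ) (r : ℝ) (u v : Phase k l) :
    Omega k l J (r • u) v = r * Omega k l J u v := by
  simp only [Omega, Finset.mul_sum, Prod.smul_fst, Prod.smul_snd, Pi.smul_apply, smul_eq_mul]
  exact Finset.sum_congr rfl fun i _ => by ring

theorem Omega_sub_left (J : Fin (k + l) → ℝ) (u u' v : Phase k l) :
    Omega k l J (u - u') v = Omega k l J u v - Omega k l J u' v := by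
  rw [sub_eq_add_neg, Omega_add_left, ← neg_one_smul ℝ u', Omega_smul_left]
  ring

theorem Omega_sub_right (J : Fin (k + l) → ℝ) (u v v' : Phase k l) :
    Omega k l J u (v - v') = Omega k l J u v - Omega k l J u v' := by
  rw [Omega_antisymm, Omega_sub_left, Omega_antisymm J v, Omega_antisymm J v']
  ring

theorem Omega_smul_right (J : Fin (k + l) → ℝ) (r : ℝ) (u v : Phase k l) :
    Omega k l J u (r • v) = r * Omega k l J u v := by
  rw [Omega_antisymm, Omega_smul_left, Omega_antisymm J v]
  ring

/-- Projection to the tangent space of the level set along its `Ω`-orthogonal complement. -/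
noncomputable def tangentProj (J : Fin (k + l) → ℝ) (x v : Phase k l) : Phase k l :=
  v - (pseudoInner k l x.1 v.1 / kFun k l J x) • normalOne J x
    - (pseudoInner k l x.2 v.2 / kFun k l J x) • normalTwo J x

theorem tangentProj_mem {J : Fin (k + l) → ℝ} {x : Phase k l} (hK : kFun k l J x ≠ 0)
    (v : Phase k l) : tangentProj J x v ∈ tangentSpaceP k l x := by
  rw [mem_tangentSpaceP]
  simp only [tangentProj, Prod.fst_sub, Prod.snd_sub, Prod.smul_fst, Prod.smul_snd,
    pseudoInner_sub_right, pseudoInner_smul_right, pseudoInner_normalOne, pseudoInner_normalTwo]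
  simp only [normalOne, normalTwo, pseudoInner_zero_right]
  constructor <;> field_simp <;> ring

theorem eq_zero_of_Omega_eq_zero {J : Fin (k + l) → ℝ} (hJ : ∀ i, J i ≠ 0) {u : Phase k l}
    (h : ∀ v, Omega k l J u v = 0) : u = 0 := by
  have key : ∀ i, u.2 i = 0 ∧ u.1 i = 0 := by
    intro i
    have h1 := h (Pi.single i 1, 0)
    have h2 := h (0, Pi.single i 1)
    rw [Omega, Finset.sum_eq_single i] at h1 h2
    · simpa [hJ i, tau_ne_zero] using And.intro h1 h2
    all_goals simp +contextual
  ext i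
  · exact (key i).2
  · exact (key i).1

/-- On the two normal vectors the pair of differentials has matrix `2K` times the identity. -/
theorem linearIndependent_fderiv_phi {J : Fin (k + l) → ℝ} {x : Phase k l}
    (hK : kFun k l J x ≠ 0) :
    LinearIndependent ℝ ![fderiv ℝ (phiOne k l) x, fderiv ℝ (phiTwo k l) x] := by
  rw [LinearIndependent.pair_iff]
  intro s t h
  have h1 := DFunLike.congr_fun h (normalOne J x)
  have h2 := DFunLike.congr_fun h (normalTwo J x)
  simp only [add_apply, smul_apply, fderiv_phiOne,
    fderiv_phiTwo, pseudoInner_normalOne, pseudoInner_normalTwo] at h1 h2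
  simp only [normalOne, normalTwo, pseudoInner_zero_right] at h1 h2
  simpa [hK] using And.intro h1 h2

theorem finrank_tangentSpaceP {J : Fin (k + l) → ℝ} {x : Phase k l} (hK : kFun k l J x ≠ 0) :
    Module.finrank ℝ (tangentSpaceP k l x) + 2 = 2 * (k + l) := by
  set g : Phase k l →ₗ[ℝ] ℝ × ℝ :=
    (fderiv ℝ (phiOne k l) x).toLinearMap.prod (fderiv ℝ (phiTwo k l) x).toLinearMap with hg
  have hker : tangentSpaceP k l x = LinearMap.ker g := by
    rw [hg, LinearMap.ker_prod, tangentSpaceP]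
  have hrange : LinearMap.range g = ⊤ := by
    rw [LinearMap.range_eq_top]
    rintro ⟨a, b⟩
    refine ⟨(a / (2 * kFun k l J x)) • normalOne J x +
      (b / (2 * kFun k l J x)) • normalTwo J x, ?_⟩
    simp only [hg, LinearMap.prod_apply, Function.prod_apply, ContinuousLinearMap.coe_coe, map_add,
      map_smul, fderiv_phiOne, fderiv_phiTwo, pseudoInner_normalOne, pseudoInner_normalTwo]
    simp only [normalOne, normalTwo, pseudoInner_zero_right]
    ext <;> simp <;> field_simp
  have h := LinearMap.finrank_range_add_finrank_ker g
  rw [← hker, hrange, finrank_top] at h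
  simp [Module.finrank_prod] at h
  omega

/-- A tangent vector is `Ω`-orthogonal to both normal vectors. If it is also orthogonal to the
tangent space, it is orthogonal to everything, because `tangentProj` changes a vector only by normal
ones. -/
theorem Omega_nondegenerate {J : Fin (k + l) → ℝ} (hJ : ∀ i, J i ≠ 0) {x : Phase k l}
    (hK : kFun k l J x ≠ 0) {u : Phase k l} (hu : u ∈ tangentSpaceP k l x)
    (h : ∀ v ∈ tangentSpaceP k l x, Omega k l J u v = 0) : u = 0 := by
  refine eq_zero_of_Omega_eq_zero hJ fun v => ?_
  have h1 := h _ (tangentProj_mem hK v)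
  rw [mem_tangentSpaceP] at hu
  rw [tangentProj, Omega_sub_right, Omega_sub_right, Omega_smul_right, Omega_smul_right,
    Omega_antisymm J u (normalOne J x), Omega_antisymm J u (normalTwo J x),
    Omega_normalOne hJ, Omega_normalTwo hJ, hu.1, hu.2] at h1
  simpa using h1

theorem fderiv_eq_sum (f : Phase k l → ℝ) (x v : Phase k l) :
    fderiv ℝ f x v = ∑ i, (dq k l f i x * v.1 i + dQ k l f i x * v.2 i) := by
  have hv : v = ∑ i, (v.1 i • ((Pi.single i 1, 0) : Phase k l) +
      v.2 i • ((0, Pi.single i 1) : Phase k l)) := by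
    ext j <;> simp [Prod.fst_sum, Prod.snd_sum, Pi.single_apply]
  conv_lhs => rw [hv]
  simp only [map_sum, map_add, map_smul, smul_eq_mul, dq, dQ]
  exact Finset.sum_congr rfl fun i _ => by ring

theorem dq_phiOne (i : Fin (k + l)) (x : Phase k l) :
    dq k l (phiOne k l) i x = 2 * (tau k l i * x.1 i) := by
  simp [dq, fderiv_phiOne, pseudoInner_single]

theorem dQ_phiOne (i : Fin (k + l)) (x : Phase k l) : dQ k l (phiOne k l) i x = 0 := by
  simp [dQ, fderiv_phiOne, pseudoInner_zero_right]

theorem dq_phiTwo (i : Fin (k + l)) (x : Phase k l) : dq k l (phiTwo k l) i x = 0 := by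
  simp [dq, fderiv_phiTwo, pseudoInner_zero_right]

theorem dQ_phiTwo (i : Fin (k + l)) (x : Phase k l) :
    dQ k l (phiTwo k l) i x = 2 * (tau k l i * x.2 i) := by
  simp [dQ, fderiv_phiTwo, pseudoInner_single]

theorem poisson_phiOne (J : Fin (k + l) → ℝ) (f : Phase k l → ℝ) (x : Phase k l) :
    poisson k l J (phiOne k l) f x = 2 * fderiv ℝ f x (normalTwo J x) := by
  rw [poisson, fderiv_eq_sum, Finset.mul_sum]
  refine Finset.sum_congr rfl fun i _ => ?_
  rw [dq_phiOne, dQ_phiOne]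
  simp only [normalTwo, Pi.zero_apply]
  linear_combination (2 * (J i)⁻¹ * x.1 i * dQ k l f i x) * tau_mul_self i

theorem poisson_phiTwo (J : Fin (k + l) → ℝ) (f : Phase k l → ℝ) (x : Phase k l) :
    poisson k l J (phiTwo k l) f x = -2 * fderiv ℝ f x (normalOne J x) := by
  rw [poisson, fderiv_eq_sum, Finset.mul_sum]
  refine Finset.sum_congr rfl fun i _ => ?_
  rw [dq_phiTwo, dQ_phiTwo]
  simp only [normalOne, Pi.zero_apply]
  linear_combination (-2 * (J i)⁻¹ * x.2 i * dq k l f i x) * tau_mul_self i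

/-- The Hamiltonian vector of `g` for `Ω` on the whole phase space. -/
noncomputable def hamVector (J : Fin (k + l) → ℝ) (g : Phase k l → ℝ) (x : Phase k l) :
    Phase k l :=
  (fun i => tau k l i / J i * dQ k l g i x, fun i => -(tau k l i / J i * dq k l g i x))

theorem Omega_hamVector {J : Fin (k + l) → ℝ} (hJ : ∀ i, J i ≠ 0) (g : Phase k l → ℝ)
    (x v : Phase k l) : Omega k l J (hamVector J g x) v = -fderiv ℝ g x v := by
  rw [Omega, fderiv_eq_sum, ← Finset.sum_neg_distrib]
  refine Finset.sum_congr rfl fun i _ => ?_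
  have hi := mul_inv_cancel₀ (hJ i)
  simp only [hamVector, div_eq_mul_inv]
  linear_combination (-(dq k l g i x * v.1 i + dQ k l g i x * v.2 i)) *
    (tau_mul_self i + tau k l i * tau k l i * hi)

theorem poisson_eq_fderiv_hamVector (J : Fin (k + l) → ℝ) (f g : Phase k l → ℝ) (x : Phase k l) :
    poisson k l J f g x = fderiv ℝ f x (hamVector J g x) := by
  rw [poisson, fderiv_eq_sum]
  refine Finset.sum_congr rfl fun i _ => ?_
  simp only [hamVector]
  ring

/-- The brackets with `φ₁` and `φ₂` are, up to factors `±2`, derivatives along the normal vectors,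
and `{φ₁, φ₂} = 4K`. The Dirac correction is therefore exactly what the projection subtracts from
the Hamiltonian vector. -/
theorem diracBracket_eq_fderiv {J : Fin (k + l) → ℝ} (x : Phase k l)
    (hK : kFun k l J x ≠ 0) (f g : Phase k l → ℝ) :
    diracBracket k l J f g x = fderiv ℝ f x (tangentProj J x (hamVector J g x)) := by
  have h1 : pseudoInner k l x.1 (hamVector J g x).1 = poisson k l J (phiOne k l) g x / 2 := by
    rw [poisson_eq_fderiv_hamVector, fderiv_phiOne]; ring
  have h2 : pseudoInner k l x.2 (hamVector J g x).2 = poisson k l J (phiTwo k l) g x / 2 := by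
    rw [poisson_eq_fderiv_hamVector, fderiv_phiTwo]; ring
  have h12 : poisson k l J (phiOne k l) (phiTwo k l) x = 4 * kFun k l J x := by
    rw [poisson_phiOne, fderiv_phiTwo, pseudoInner_normalTwo]; ring
  rw [diracBracket, tangentProj, map_sub, map_sub, map_smul, map_smul, h1, h2, h12,
    poisson_eq_fderiv_hamVector J f g, poisson_phiOne J f, poisson_phiTwo J f, smul_eq_mul,
    smul_eq_mul]
  field_simp
  ring

theorem Omega_tangentProj {J : Fin (k + l) → ℝ} (hJ : ∀ i, J i ≠ 0) (x u : Phase k l)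
    {v : Phase k l} (hv : v ∈ tangentSpaceP k l x) :
    Omega k l J (tangentProj J x u) v = Omega k l J u v := by
  rw [mem_tangentSpaceP] at hv
  rw [tangentProj, Omega_sub_left, Omega_sub_left, Omega_smul_left, Omega_smul_left,
    Omega_normalOne hJ, Omega_normalTwo hJ, hv.1, hv.2]
  simp

end Prelim

/-! ### The map preserves `P_c^*` and `Ω`. -/

section HeisenbergMap
variable {k l : ℕ} {J : Fin (k + l) → ℝ} {x : Phase k l}

theorem phiTwo_heisenbergMap (hS : singFun k l J x ≠ 0) :
    phiTwo k l (heisenbergMap k l J x) = phiOne k l x := by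
  -- The multiplier is the root, nonzero when `K ≠ 0`, of `λ² ⟨J⁻²Q, Q⟩ - 2λK = 0`.
  have h : phiTwo k l (heisenbergMap k l J x) = multiplier k l J x ^ 2 * singFun k l J x
      - 2 * multiplier k l J x * kFun k l J x + phiOne k l x := by
    simp only [phiTwo, phiOne, heisenbergMap, singFun, kFun, pseudoInner, Finset.mul_sum,
      ← Finset.sum_add_distrib, ← Finset.sum_sub_distrib]
    refine Finset.sum_congr rfl fun i _ => ?_
    rw [← inv_pow]
    ring
  rw [h, multiplier]
  field_simp
  ring

theorem kFun_heisenbergMap (hS : singFun k l J x ≠ 0) :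
    kFun k l J (heisenbergMap k l J x) = kFun k l J x := by
  have h : kFun k l J (heisenbergMap k l J x) = multiplier k l J x * singFun k l J x
      - kFun k l J x := by
    simp only [heisenbergMap, singFun, kFun, pseudoInner, Finset.mul_sum,
      ← Finset.sum_sub_distrib]
    refine Finset.sum_congr rfl fun i _ => ?_
    rw [← inv_pow]
    ring
  rw [h, multiplier]
  field_simp
  ring

theorem heisenbergMap_mem {c : ℝ} (hx : x ∈ PStarDom k l c J) :
    heisenbergMap k l J x ∈ PStar k l c J := by
  obtain ⟨⟨h1, h2, hK⟩, hS⟩ := hx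
  exact ⟨h2, (phiTwo_heisenbergMap hS).trans h1, by rwa [kFun_heisenbergMap hS]⟩

theorem contDiffAt_multiplier {n : WithTop ℕ∞} (hS : singFun k l J x ≠ 0) :
    ContDiffAt ℝ n (multiplier k l J) x :=
  (contDiff_const.mul (contDiff_kFun J)).contDiffAt.div (contDiff_singFun J).contDiffAt hS

theorem contDiffAt_heisenbergMap {n : WithTop ℕ∞} (hS : singFun k l J x ≠ 0) :
    ContDiffAt ℝ n (heisenbergMap k l J) x := by
  refine contDiff_snd.contDiffAt.prodMk (contDiffAt_pi.2 fun i => ?_)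
  exact (((contDiffAt_multiplier hS).mul contDiffAt_const).mul
    (contDiff_snd_apply i).contDiffAt).sub (contDiff_fst_apply i).contDiffAt

theorem fderiv_heisenbergMap (hS : singFun k l J x ≠ 0) (u : Phase k l) :
    fderiv ℝ (heisenbergMap k l J) x u =
      (u.2, fun i => fderiv ℝ (multiplier k l J) x u * (J i)⁻¹ * x.2 i +
        multiplier k l J x * (J i)⁻¹ * u.2 i - u.1 i) := by
  refine fderiv_apply_eq_of_hasDerivAt
    ((contDiffAt_heisenbergMap (n := 1) hS).differentiableAt (by norm_num)) ?_
  have hm := ((contDiffAt_multiplier (n := 1) hS).differentiableAt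
    (by norm_num)).hasFDerivAt.hasLineDerivAt u
  refine HasDerivAt.prodMk (hasDerivAt_pi.2 fun i => hasDerivAt_line _ _)
    (hasDerivAt_pi.2 fun i => ?_)
  refine (((hm.mul_const (J i)⁻¹).mul (hasDerivAt_line (x.2 i) (u.2 i))).sub
    (hasDerivAt_line (x.1 i) (u.1 i))).congr_deriv ?_
  simp

theorem fderiv_heisenbergMap_mem (hS : singFun k l J x ≠ 0) {u : Phase k l}
    (hu : u ∈ tangentSpaceP k l x) :
    fderiv ℝ (heisenbergMap k l J) x u ∈ tangentSpaceP k l (heisenbergMap k l J x) := by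
  have hd : DifferentiableAt ℝ (heisenbergMap k l J) x :=
    (contDiffAt_heisenbergMap (n := 1) hS).differentiableAt (by norm_num)
  -- The identity holds near `x`, on and off the level set, so it may be differentiated.
  have h2 : phiTwo k l ∘ heisenbergMap k l J =ᶠ[nhds x] phiOne k l := by
    filter_upwards [(contDiff_singFun (n := 0) J).continuous.continuousAt.eventually_ne hS]
      with y hy using phiTwo_heisenbergMap hy
  have h3 := DFunLike.congr_fun (h2.fderiv_eq (𝕜 := ℝ)) u
  rw [fderiv_comp x ((contDiff_phiTwo (n := 1)).differentiable (by norm_num) _) hd] at h3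
  rw [mem_tangentSpaceP] at hu ⊢
  constructor
  · rw [fderiv_heisenbergMap hS]
    exact hu.2
  · rw [ContinuousLinearMap.comp_apply, fderiv_phiTwo, fderiv_phiOne, hu.1] at h3
    linarith

theorem Omega_fderiv_heisenbergMap (hJ : ∀ i, J i ≠ 0) (hS : singFun k l J x ≠ 0)
    {u v : Phase k l} (hu : u ∈ tangentSpaceP k l x) (hv : v ∈ tangentSpaceP k l x) :
    Omega k l J (fderiv ℝ (heisenbergMap k l J) x u) (fderiv ℝ (heisenbergMap k l J) x v) =
      Omega k l J u v := by
  rw [mem_tangentSpaceP] at hu hv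
  -- The terms `λJ⁻¹ dQ` cancel by symmetry; the terms in `dλ` carry factors that vanish for tangent
  -- `u`, `v`.
  have h : Omega k l J (fderiv ℝ (heisenbergMap k l J) x u)
      (fderiv ℝ (heisenbergMap k l J) x v) =
      fderiv ℝ (multiplier k l J) x u * pseudoInner k l x.2 v.2 -
      fderiv ℝ (multiplier k l J) x v * pseudoInner k l x.2 u.2 + Omega k l J u v := by
    rw [fderiv_heisenbergMap hS, fderiv_heisenbergMap hS]
    simp only [Omega, pseudoInner, Finset.mul_sum, ← Finset.sum_add_distrib,
      ← Finset.sum_sub_distrib]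
    refine Finset.sum_congr rfl fun i _ => ?_
    have := hJ i
    field_simp
    ring
  rw [h, hu.2, hv.2]
  ring

end HeisenbergMap

/-! ### Conservation and involution of the integrals. -/

section Integrals
variable {k l : ℕ} {J : Fin (k + l) → ℝ}

/-- The added diagonal term is `0 / 0`, which is `0`. -/
theorem heisenbergIntegral_eq (c : ℝ) (i : Fin (k + l)) (x : Phase k l) :
    heisenbergIntegral k l c J i x = c * tau k l i * x.1 i ^ 2 +
      ∑ j, tau k l i * tau k l j *
        (J j * x.2 j * x.1 i - x.1 j * J i * x.2 i) ^ 2 / (J i ^ 2 - J j ^ 2) := by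
  rw [heisenbergIntegral, Finset.sum_erase]
  simp

theorem heisenbergIntegral_heisenbergMap (hJ : ∀ i, J i ≠ 0)
    (hJJ : ∀ i j, i ≠ j → J i ^ 2 ≠ J j ^ 2) {c : ℝ} {x : Phase k l}
    (hx : x ∈ PStar k l c J) (i : Fin (k + l)) :
    heisenbergIntegral k l c J i (heisenbergMap k l J x) = heisenbergIntegral k l c J i x := by
  -- The multiplier cancels from the new `q ∧ p`, so its value is irrelevant here. The difference of
  -- the squared entries is `(J_i² - J_j²)(q_i²Q_j² - q_j²Q_i²)`, whose first factor cancels the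
  -- denominator.
  have h : heisenbergIntegral k l c J i (heisenbergMap k l J x) -
      heisenbergIntegral k l c J i x = c * tau k l i * (x.2 i ^ 2 - x.1 i ^ 2) -
      tau k l i * (x.2 i ^ 2 * phiOne k l x - x.1 i ^ 2 * phiTwo k l x) := by
    simp only [heisenbergIntegral_eq, phiOne, phiTwo, pseudoInner, Finset.mul_sum]
    rw [add_sub_add_comm, ← Finset.sum_sub_distrib, ← Finset.sum_sub_distrib, Finset.mul_sum,
      sub_eq_add_neg _ (∑ i, _), ← Finset.sum_neg_distrib]
    congr 1
    · simp only [heisenbergMap]; ring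
    · refine Finset.sum_congr rfl fun j _ => ?_
      rcases eq_or_ne i j with rfl | hij
      · rw [sub_self, div_zero, div_zero]; ring
      · have := sub_ne_zero.2 (hJJ i j hij)
        have hi := hJ i
        have hj := hJ j
        simp only [heisenbergMap]
        field_simp
        ring
  rw [hx.1, hx.2.1] at h
  linarith

/-- The quadratic terms in `q ∧ p` are antisymmetric in the two indices. -/
theorem sum_heisenbergIntegral (c : ℝ) (x : Phase k l) :
    ∑ i, heisenbergIntegral k l c J i x = c * phiOne k l x := by
  simp only [heisenbergIntegral_eq, Finset.sum_add_distrib]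
  have h : ∀ a : Fin (k + l) → Fin (k + l) → ℝ, (∀ i j, a i j = -a j i) →
      ∑ i, ∑ j, a i j = 0 := by
    intro a ha
    have h1 : ∑ i, ∑ j, a i j = -∑ i, ∑ j, a i j := by
      conv_lhs => rw [Finset.sum_comm]
      simp only [← Finset.sum_neg_distrib]
      exact Finset.sum_congr rfl fun i _ => Finset.sum_congr rfl fun j _ => ha j i
    linarith
  rw [h, phiOne, pseudoInner, Finset.mul_sum, add_zero]
  · exact Finset.sum_congr rfl fun i _ => by ring
  · intro i j
    rw [← neg_sub (J j ^ 2), div_neg]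
    ring

/-- `τ_i τ_j (p_j q_i - q_j p_i) / (J_i² - J_j²)` with `p = J Q`. -/
noncomputable def momentCoeff (J : Fin (k + l) → ℝ) (x : Phase k l) (i j : Fin (k + l)) : ℝ :=
  tau k l i * tau k l j * (J j * x.2 j * x.1 i - x.1 j * J i * x.2 i) / (J i ^ 2 - J j ^ 2)

theorem momentCoeff_symm (x : Phase k l) (i j : Fin (k + l)) :
    momentCoeff J x i j = momentCoeff J x j i := by
  rw [momentCoeff, momentCoeff, ← neg_sub (J j ^ 2), div_neg]
  ring

theorem momentCoeff_self (x : Phase k l) (i : Fin (k + l)) : momentCoeff J x i i = 0 := by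
  simp [momentCoeff]

theorem fderiv_heisenbergIntegral (c : ℝ) (i : Fin (k + l)) (x u : Phase k l) :
    fderiv ℝ (heisenbergIntegral k l c J i) x u = 2 * c * tau k l i * x.1 i * u.1 i +
      ∑ j, 2 * momentCoeff J x i j * (J j * u.2 j * x.1 i + J j * x.2 j * u.1 i
        - u.1 j * J i * x.2 i - x.1 j * J i * u.2 i) := by
  refine fderiv_apply_eq_of_hasDerivAt
    ((contDiff_heisenbergIntegral (n := 1) c J i).differentiable (by norm_num) x) ?_
  simp only [heisenbergIntegral_eq]
  have h1 := fun j => hasDerivAt_line (x.1 j) (u.1 j)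
  have h2 := fun j => hasDerivAt_line (x.2 j) (u.2 j)
  refine HasDerivAt.add ?_ (HasDerivAt.fun_sum fun j _ => ?_)
  · exact (((h1 i).pow 2).const_mul (c * tau k l i)).congr_deriv (by simp; ring)
  · refine ((((((h2 j).const_mul (J j)).mul (h1 i)).sub
      (((h1 j).mul_const (J i)).mul (h2 i))).pow 2).const_mul
        (tau k l i * tau k l j)).div_const (J i ^ 2 - J j ^ 2) |>.congr_deriv ?_
    simp [momentCoeff]
    ring

theorem dq_heisenbergIntegral (c : ℝ) (i m : Fin (k + l)) (x : Phase k l) :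
    dq k l (heisenbergIntegral k l c J i) m x =
      (if m = i then 2 * (c * tau k l i * x.1 i + ∑ j, momentCoeff J x i j * (J j * x.2 j))
        else 0) - 2 * momentCoeff J x i m * (J i * x.2 i) := by
  rw [dq, fderiv_heisenbergIntegral]
  simp only [Pi.zero_apply, Pi.single_apply, mul_add, mul_sub, Finset.sum_add_distrib,
    Finset.sum_sub_distrib]
  rcases eq_or_ne m i with rfl | h
  · simp [Finset.mul_sum, momentCoeff_self, mul_assoc]
  · simp [h, h.symm]

theorem dQ_heisenbergIntegral (c : ℝ) (i m : Fin (k + l)) (x : Phase k l) :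
    dQ k l (heisenbergIntegral k l c J i) m x =
      J m * ((if m = i then -2 * ∑ j, momentCoeff J x i j * x.1 j else 0)
        + 2 * momentCoeff J x i m * x.1 i) := by
  rw [dQ, fderiv_heisenbergIntegral]
  simp only [Pi.zero_apply, Pi.single_apply, mul_add, mul_sub, Finset.sum_add_distrib,
    Finset.sum_sub_distrib]
  rcases eq_or_ne m i with rfl | h
  · simp [Finset.mul_sum, momentCoeff_self]
    exact Finset.sum_congr rfl fun i _ => by ring
  · simp [h, h.symm]
    ring

/-- `φ₁` generates, up to scale, the shift `p ↦ p + sq`, which fixes `q` and `q ∧ p`. -/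
theorem poisson_phiOne_heisenbergIntegral (hJ : ∀ i, J i ≠ 0) (c : ℝ) (i : Fin (k + l))
    (x : Phase k l) : poisson k l J (phiOne k l) (heisenbergIntegral k l c J i) x = 0 := by
  rw [poisson_phiOne, fderiv_heisenbergIntegral]
  simp only [normalTwo, Pi.zero_apply]
  rw [Finset.sum_eq_zero]
  · simp
  · intro j _
    have hi := hJ i
    have hj := hJ j
    field_simp
    ring

theorem momentCoeff_identity (hJJ : ∀ i j, i ≠ j → J i ^ 2 ≠ J j ^ 2) (x : Phase k l)
    {i j : Fin (k + l)} (hij : i ≠ j) (m : Fin (k + l)) :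
    momentCoeff J x i j *
      (tau k l i * momentCoeff J x i m * (J m * x.2 m * x.1 j - x.1 m * J j * x.2 j) -
        tau k l j * momentCoeff J x j m * (J m * x.2 m * x.1 i - x.1 m * J i * x.2 i)) +
      tau k l m * (J j * x.2 j * x.1 i - x.1 j * J i * x.2 i) *
        momentCoeff J x i m * momentCoeff J x j m = 0 := by
  rcases eq_or_ne i m with rfl | him
  · rw [momentCoeff_self]; ring
  rcases eq_or_ne j m with rfl | hjm
  · rw [momentCoeff_self]; ring
  have h1 := sub_ne_zero.2 (hJJ i j hij)
  have h2 := sub_ne_zero.2 (hJJ i m him)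
  have h3 := sub_ne_zero.2 (hJJ j m hjm)
  simp only [momentCoeff]
  have ti := tau_sq (k := k) (l := l) i
  have tj := tau_sq (k := k) (l := l) j
  have tm := tau_sq (k := k) (l := l) m
  generalize tau k l i = a at *
  generalize tau k l j = b at *
  generalize tau k l m = d at *
  generalize J m * x.2 m * x.1 j - x.1 m * J j * x.2 j = y
  generalize J m * x.2 m * x.1 i - x.1 m * J i * x.2 i = z
  generalize J j * x.2 j * x.1 i - x.1 j * J i * x.2 i = w
  generalize J i ^ 2 = A at *
  generalize J j ^ 2 = B at *
  generalize J m ^ 2 = C at *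
  have e : ∀ a b w d : ℝ, a * b * w / d = a * b * w * d⁻¹ := fun _ _ _ _ => rfl
  -- Up to squares of signs, the three terms share the factor `a * b * d * w * y * z`; this is what
  -- remains.
  have key : (A - B)⁻¹ * (A - C)⁻¹ - (A - B)⁻¹ * (B - C)⁻¹ + (A - C)⁻¹ * (B - C)⁻¹ = 0 := by
    field_simp
    ring
  simp only [e]
  have r : a ^ 3 = a := by rw [pow_succ, ti, one_mul]
  linear_combination (a * b * d * w * y * z) * key +
    (a * b * d * w * y * z * (A - B)⁻¹ * (A - C)⁻¹) * ti -
    (a * b * d * w * y * z * (A - B)⁻¹ * (B - C)⁻¹) * tj +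
    (a * b * d * w * y * z * (A - C)⁻¹ * (B - C)⁻¹) * tm

theorem poisson_heisenbergIntegral (hJ : ∀ i, J i ≠ 0)
    (hJJ : ∀ i j, i ≠ j → J i ^ 2 ≠ J j ^ 2) (c : ℝ) {i j : Fin (k + l)} (hij : i ≠ j)
    (x : Phase k l) :
    poisson k l J (heisenbergIntegral k l c J i) (heisenbergIntegral k l c J j) x = 0 := by
  set y := momentCoeff J x with hy
  set R : Fin (k + l) → ℝ := fun i => c * tau k l i * x.1 i + ∑ m, y i m * (J m * x.2 m) with hR
  set T : Fin (k + l) → ℝ := fun i => ∑ m, y i m * x.1 m with hT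
  -- The factor `J_m` of `∂/∂Q_m = J_m ∂/∂p_m` cancels the `1 / J_m` of the bracket.
  have h1 : poisson k l J (heisenbergIntegral k l c J i) (heisenbergIntegral k l c J j) x =
      ∑ m, tau k l m * (((if m = i then 2 * R i else 0) - 2 * y i m * (J i * x.2 i)) *
        ((if m = j then -2 * T j else 0) + 2 * y j m * x.1 j) -
        ((if m = i then -2 * T i else 0) + 2 * y i m * x.1 i) *
        ((if m = j then 2 * R j else 0) - 2 * y j m * (J j * x.2 j))) := by
    refine Finset.sum_congr rfl fun m _ => ?_
    simp only [dq_heisenbergIntegral, dQ_heisenbergIntegral, hR, hT]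
    have e := div_mul_cancel₀ (tau k l m) (hJ m)
    linear_combination (((if m = i then 2 * (c * tau k l i * x.1 i +
      ∑ j, y i j * (J j * x.2 j)) else 0) - 2 * y i m * (J i * x.2 i)) *
        ((if m = j then -2 * ∑ n, y j n * x.1 n else 0) + 2 * y j m * x.1 j) -
        ((if m = i then -2 * ∑ n, y i n * x.1 n else 0) + 2 * y i m * x.1 i) *
        ((if m = j then 2 * (c * tau k l j * x.1 j +
      ∑ n, y j n * (J n * x.2 n)) else 0) - 2 * y j m * (J j * x.2 j))) * e
  have h2 : poisson k l J (heisenbergIntegral k l c J i) (heisenbergIntegral k l c J j) x =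
      4 * (y i j * (tau k l i * (R i * x.1 j - T i * (J j * x.2 j)) +
        tau k l j * (J i * x.2 i * T j - x.1 i * R j)) +
      ∑ m, tau k l m * (J j * x.2 j * x.1 i - x.1 j * J i * x.2 i) * y i m * y j m) := by
    rw [h1]
    have hs : y j i = y i j := momentCoeff_symm x j i
    trans ∑ m, ((if m = i then 4 * (tau k l i * y i j * (R i * x.1 j - T i * (J j * x.2 j)))
        else 0) + (if m = j then 4 * (tau k l j * y i j * (J i * x.2 i * T j - x.1 i * R j))
        else 0) + 4 * (tau k l m * (J j * x.2 j * x.1 i - x.1 j * J i * x.2 i) * y i m * y j m))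
    · refine Finset.sum_congr rfl fun m _ => ?_
      rcases eq_or_ne m i with rfl | hmi
      · simp [hij, hs]; ring
      rcases eq_or_ne m j with rfl | hmj
      · simp [hmi]; ring
      simp [hmi, hmj]; ring
    · simp only [Finset.sum_add_distrib, Finset.sum_ite_eq', Finset.mem_univ, if_true,
        ← Finset.mul_sum]
      ring
  have h3 : R i * x.1 j - T i * (J j * x.2 j) = c * tau k l i * x.1 i * x.1 j +
      ∑ m, y i m * (J m * x.2 m * x.1 j - x.1 m * J j * x.2 j) := by
    simp only [hR, hT, add_mul, Finset.sum_mul, mul_sub, Finset.sum_sub_distrib]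
    rw [add_sub_assoc]
    congr 2 <;> exact Finset.sum_congr rfl fun m _ => by ring
  have h4 : J i * x.2 i * T j - x.1 i * R j = -(c * tau k l j * x.1 i * x.1 j) -
      ∑ m, y j m * (J m * x.2 m * x.1 i - x.1 m * J i * x.2 i) := by
    simp only [hR, hT, mul_add, Finset.mul_sum, mul_sub, Finset.sum_sub_distrib]
    have e1 : ∑ m, J i * x.2 i * (y j m * x.1 m) = ∑ m, y j m * (x.1 m * J i * x.2 i) :=
      Finset.sum_congr rfl fun m _ => by ring
    have e2 : ∑ m, x.1 i * (y j m * (J m * x.2 m)) = ∑ m, y j m * (J m * x.2 m * x.1 i) :=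
      Finset.sum_congr rfl fun m _ => by ring
    rw [e1, e2]
    ring
  -- Summing the identity over `m` kills everything except the two terms in `c`, which cancel since
  -- `τ_i² = τ_j²`.
  have h5 := Finset.sum_congr rfl fun m (_ : m ∈ Finset.univ) =>
    momentCoeff_identity hJJ x hij m
  rw [Finset.sum_add_distrib, Finset.sum_const_zero, ← Finset.mul_sum, Finset.sum_sub_distrib]
    at h5
  simp only [mul_assoc (tau k l i), mul_assoc (tau k l j), ← Finset.mul_sum] at h5
  rw [h2, h3, h4]
  simp only [hy] at *
  linear_combination 4 * h5 + 4 * momentCoeff J x i j * c * x.1 i * x.1 j *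
    (tau_mul_self i - tau_mul_self j)

theorem diracBracket_heisenbergIntegral (hJ : ∀ i, J i ≠ 0)
    (hJJ : ∀ i j, i ≠ j → J i ^ 2 ≠ J j ^ 2) (c : ℝ) (i j : Fin (k + l)) (x : Phase k l) :
    diracBracket k l J (heisenbergIntegral k l c J i) (heisenbergIntegral k l c J j) x = 0 := by
  rw [diracBracket, poisson_phiOne_heisenbergIntegral hJ, poisson_phiOne_heisenbergIntegral hJ]
  rcases eq_or_ne i j with rfl | hij
  · simp [poisson, mul_comm]
  · simp [poisson_heisenbergIntegral hJ hJJ c hij]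

end Integrals

/-! ### The characteristic polynomial of the Lax matrix. -/

section LaxMatrix

theorem det_diagonal_add_wedge {ι : Type*} [Fintype ι] [DecidableEq ι] {D : ι → ℂ}
    (hD : ∀ i, D i ≠ 0) (a b : ι → ℂ) (z c : ℂ) :
    (Matrix.diagonal D - z • (Matrix.vecMulVec a b - Matrix.vecMulVec b a) +
      (z ^ 2 * c) • Matrix.vecMulVec a a).det =
    (∏ i, D i) * (1 + z ^ 2 * (c * ∑ i, a i ^ 2 * (D i)⁻¹ +
      ((∑ i, a i ^ 2 * (D i)⁻¹) * (∑ i, b i ^ 2 * (D i)⁻¹) -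
        (∑ i, a i * b i * (D i)⁻¹) ^ 2))) := by
  -- The term in `a ⊗ a` is absorbed into the first row of `V`, so two columns suffice for the
  -- determinant lemma `det (D + UV) = det D · det (1 + V D⁻¹ U)`.
  set U : Matrix ι (Fin 2) ℂ := Matrix.of fun i => ![a i, z * b i] with hU
  set V : Matrix (Fin 2) ι ℂ := Matrix.of ![fun j => -(z * b j) + z ^ 2 * c * a j, a] with hV
  have h1 : Matrix.diagonal D - z • (Matrix.vecMulVec a b - Matrix.vecMulVec b a) +
      (z ^ 2 * c) • Matrix.vecMulVec a a = Matrix.diagonal D + U * V := by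
    ext i j
    simp [hU, hV, Matrix.mul_apply, Fin.sum_univ_two, Matrix.vecMulVec_apply]
    ring
  have hinv : (Matrix.diagonal D)⁻¹ = Matrix.diagonal fun i => (D i)⁻¹ := by
    refine Matrix.inv_eq_right_inv ?_
    rw [Matrix.diagonal_mul_diagonal, ← Matrix.diagonal_one]
    congr 1
    ext i
    exact mul_inv_cancel₀ (hD i)
  have hdet : IsUnit (Matrix.diagonal D).det := by
    rw [Matrix.det_diagonal, isUnit_iff_ne_zero]
    exact Finset.prod_ne_zero_iff.2 fun i _ => hD i
  have hent : ∀ p q, (V * (Matrix.diagonal D)⁻¹ * U) p q = ∑ i, V p i * (D i)⁻¹ * U i q := by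
    intro p q
    rw [hinv, Matrix.mul_apply]
    simp only [Matrix.mul_diagonal]
  have e00 : (V * (Matrix.diagonal D)⁻¹ * U) 0 0 = -z * ∑ i, a i * b i * (D i)⁻¹ +
      z ^ 2 * c * ∑ i, a i ^ 2 * (D i)⁻¹ := by
    rw [hent, Finset.mul_sum, Finset.mul_sum, ← Finset.sum_add_distrib]
    refine Finset.sum_congr rfl fun i _ => ?_
    simp [hU, hV]
    ring
  have e01 : (V * (Matrix.diagonal D)⁻¹ * U) 0 1 = -z ^ 2 * ∑ i, b i ^ 2 * (D i)⁻¹ +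
      z ^ 3 * c * ∑ i, a i * b i * (D i)⁻¹ := by
    rw [hent, Finset.mul_sum, Finset.mul_sum, ← Finset.sum_add_distrib]
    refine Finset.sum_congr rfl fun i _ => ?_
    simp [hU, hV]
    ring
  have e10 : (V * (Matrix.diagonal D)⁻¹ * U) 1 0 = ∑ i, a i ^ 2 * (D i)⁻¹ := by
    rw [hent]
    refine Finset.sum_congr rfl fun i _ => ?_
    simp [hU, hV]
    ring
  have e11 : (V * (Matrix.diagonal D)⁻¹ * U) 1 1 = z * ∑ i, a i * b i * (D i)⁻¹ := by
    rw [hent, Finset.mul_sum]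
    refine Finset.sum_congr rfl fun i _ => ?_
    simp [hU, hV]
    ring
  rw [h1, Matrix.det_add_mul U V hdet, Matrix.det_diagonal, Matrix.det_fin_two]
  simp only [Matrix.add_apply, e00, e01, e10, e11, Matrix.one_apply_eq,
    Matrix.one_apply_ne (zero_ne_one : (0 : Fin 2) ≠ 1),
    Matrix.one_apply_ne (one_ne_zero : (1 : Fin 2) ≠ 0)]
  ring

/-- A Lagrange-type identity for weighted sums, in partial fractions. -/
theorem sum_mul_sum_sub_sq {ι : Type*} [Fintype ι] {d : ι → ℂ} {m : ℂ}
    (hd : ∀ i j, i ≠ j → d i ≠ d j) (hm : ∀ i, m - d i ≠ 0) (a b : ι → ℂ) :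
    (∑ i, a i ^ 2 * (m - d i)⁻¹) * (∑ i, b i ^ 2 * (m - d i)⁻¹) -
        (∑ i, a i * b i * (m - d i)⁻¹) ^ 2 =
      ∑ i, ∑ j, (a i * b j - a j * b i) ^ 2 / (d i - d j) * (m - d i)⁻¹ := by
  set S := ∑ i, ∑ j, (a i * b j - a j * b i) ^ 2 / (d i - d j) * (m - d i)⁻¹ with hS
  have h1 : S = ∑ i, ∑ j, -((a i * b j - a j * b i) ^ 2 / (d i - d j) * (m - d j)⁻¹) := by
    rw [hS, Finset.sum_comm]
    refine Finset.sum_congr rfl fun i _ => Finset.sum_congr rfl fun j _ => ?_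
    rw [← neg_sub (d i), div_neg]
    ring
  have h2 : S + S = ∑ i, ∑ j, (a i ^ 2 * (m - d i)⁻¹ * (b j ^ 2 * (m - d j)⁻¹) +
      b i ^ 2 * (m - d i)⁻¹ * (a j ^ 2 * (m - d j)⁻¹) -
      2 * (a i * b i * (m - d i)⁻¹ * (a j * b j * (m - d j)⁻¹))) := by
    -- Adding the sum to its transpose produces `(m - d_i)⁻¹ - (m - d_j)⁻¹`, which is `d_i - d_j`
    -- times the product of the two inverses.
    conv_lhs => arg 2; rw [h1]
    rw [hS]
    simp only [← Finset.sum_add_distrib]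
    refine Finset.sum_congr rfl fun i _ => Finset.sum_congr rfl fun j _ => ?_
    rcases eq_or_ne i j with rfl | hij
    · ring
    · have e1 := hm i
      have e2 := hm j
      have e3 := sub_ne_zero.2 (hd i j hij)
      field_simp
      ring
  simp only [Finset.sum_add_distrib, Finset.sum_sub_distrib, ← Finset.mul_sum,
    ← Finset.sum_mul] at h2
  linear_combination -(1 / 2 : ℂ) * h2

variable {k l : ℕ} {J : Fin (k + l) → ℝ}

theorem Fdiag_sq (i : Fin (k + l)) : Fdiag k l i ^ 2 = (tau k l i : ℂ) := by
  unfold Fdiag tau; split_ifs <;> simp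

theorem det_sub_laxMatrix (hJJ : ∀ i j, i ≠ j → J i ^ 2 ≠ J j ^ 2) (c : ℝ) (x : Phase k l)
    (z m : ℂ) :
    (m • (1 : Matrix (Fin (k + l)) (Fin (k + l)) ℂ) - laxMatrix k l c J x z).det =
      ∏ i, (m - (J i : ℂ) ^ 2) +
        z ^ 2 * ∑ i, (heisenbergIntegral k l c J i x : ℂ) *
          ∏ j ∈ Finset.univ.erase i, (m - (J j : ℂ) ^ 2) := by
  -- Both sides are continuous in `m`, so the finitely many values at which `m - J²` is singular may
  -- be left out.
  have hdense : Dense (Set.range fun i : Fin (k + l) => (J i : ℂ) ^ 2)ᶜ :=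
    (Set.finite_range _).countable.dense_compl ℂ
  refine congrFun (Continuous.ext_on hdense (f := fun m : ℂ =>
    (m • (1 : Matrix (Fin (k + l)) (Fin (k + l)) ℂ) - laxMatrix k l c J x z).det)
    (g := fun m =>
      ∏ i, (m - (J i : ℂ) ^ 2) + z ^ 2 * ∑ i, (heisenbergIntegral k l c J i x : ℂ) *
        ∏ j ∈ Finset.univ.erase i, (m - (J j : ℂ) ^ 2)) ?_ ?_ ?_) m
  · refine Continuous.matrix_det ?_
    fun_prop
  · fun_prop
  intro m hm
  have hm' : ∀ i, m - (J i : ℂ) ^ 2 ≠ 0 := fun i h => hm ⟨i, (sub_eq_zero.1 h).symm⟩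
  have hd : ∀ i j : Fin (k + l), i ≠ j → (J i : ℂ) ^ 2 ≠ (J j : ℂ) ^ 2 := fun i j hij h =>
    hJJ i j hij (by exact_mod_cast h)
  set a : Fin (k + l) → ℂ := fun i => Fdiag k l i * (x.1 i : ℂ) with ha
  set b : Fin (k + l) → ℂ := fun i => Fdiag k l i * ((J i * x.2 i : ℝ) : ℂ) with hb
  have hL : m • (1 : Matrix (Fin (k + l)) (Fin (k + l)) ℂ) - laxMatrix k l c J x z =
      Matrix.diagonal (fun i => m - (J i : ℂ) ^ 2) -
        z • (Matrix.vecMulVec a b - Matrix.vecMulVec b a) +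
        (z ^ 2 * (c : ℂ)) • Matrix.vecMulVec a a := by
    have : Matrix.diagonal (fun i => m - (J i : ℂ) ^ 2) =
        m • (1 : Matrix (Fin (k + l)) (Fin (k + l)) ℂ) -
          Matrix.diagonal (fun i => ((J i ^ 2 : ℝ) : ℂ)) := by
      rw [← Matrix.diagonal_one, ← Matrix.diagonal_smul, Matrix.diagonal_sub]
      congr 1
      ext i
      simp
    rw [this, laxMatrix]
    simp only [← ha, ← hb]
    abel
  have hf : ∀ i, (heisenbergIntegral k l c J i x : ℂ) = c * a i ^ 2 +
      ∑ j, (a i * b j - a j * b i) ^ 2 / ((J i : ℂ) ^ 2 - (J j : ℂ) ^ 2) := by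
    intro i
    rw [heisenbergIntegral_eq]
    push_cast
    simp only [ha, hb, mul_pow, ← Fdiag_sq]
    push_cast
    congr 1
    · ring
    · refine Finset.sum_congr rfl fun j _ => ?_
      congr 1
      ring
  show Matrix.det _ = _
  rw [hL, det_diagonal_add_wedge hm', sum_mul_sum_sub_sq hd hm']
  have hsum : c * ∑ i, a i ^ 2 * (m - (J i : ℂ) ^ 2)⁻¹ + ∑ i, ∑ j,
      (a i * b j - a j * b i) ^ 2 / ((J i : ℂ) ^ 2 - (J j : ℂ) ^ 2) * (m - (J i : ℂ) ^ 2)⁻¹ =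
      ∑ i, (heisenbergIntegral k l c J i x : ℂ) * (m - (J i : ℂ) ^ 2)⁻¹ := by
    rw [Finset.mul_sum, ← Finset.sum_add_distrib]
    refine Finset.sum_congr rfl fun i _ => ?_
    rw [hf, add_mul, Finset.sum_mul, mul_assoc]
  rw [hsum, mul_add, mul_one, mul_left_comm, Finset.mul_sum]
  congr 2
  refine Finset.sum_congr rfl fun i _ => ?_
  rw [← Finset.mul_prod_erase Finset.univ _ (Finset.mem_univ i)]
  have := hm' i
  field_simp

end LaxMatrix

/-! ### Rank of the differentials and openness of the regular set. -/

section Regular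
variable {k l : ℕ} {J : Fin (k + l) → ℝ} {c : ℝ}

theorem eq_of_vanish_on_tangentSpaceP {x : Phase k l} (hK : kFun k l J x ≠ 0)
    {L : Phase k l →L[ℝ] ℝ} (hL : ∀ u ∈ tangentSpaceP k l x, L u = 0) :
    L = (L (normalOne J x) / (2 * kFun k l J x)) • fderiv ℝ (phiOne k l) x +
      (L (normalTwo J x) / (2 * kFun k l J x)) • fderiv ℝ (phiTwo k l) x := by
  refine ContinuousLinearMap.ext fun v => ?_
  have h := hL _ (tangentProj_mem hK v)
  simp only [tangentProj, map_sub, map_smul, smul_eq_mul] at h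
  simp only [add_apply, smul_apply, fderiv_phiOne, fderiv_phiTwo, smul_eq_mul]
  rw [sub_eq_zero, sub_eq_iff_eq_add] at h
  rw [h]
  field_simp
  ring

theorem sum_fderiv_heisenbergIntegral (x u : Phase k l) :
    ∑ i, fderiv ℝ (heisenbergIntegral k l c J i) x u = c * fderiv ℝ (phiOne k l) x u := by
  have h : (fun x => ∑ i, heisenbergIntegral k l c J i x) = fun x => c * phiOne k l x :=
    funext fun x => sum_heisenbergIntegral c x
  have h1 := DFunLike.congr_fun (congrArg (fun f => fderiv ℝ f x) h) u
  rw [fderiv_fun_sum fun i _ =>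
      (contDiff_heisenbergIntegral (n := 1) c J i).differentiable (by norm_num) x,
    fderiv_const_mul ((contDiff_phiOne (n := 1)).differentiable (by norm_num) x)] at h1
  simpa using h1

/-- A family of covectors whose linear independence at a point of `P_c^*` expresses that the
point is regular. -/
noncomputable def regularityFamily (c : ℝ) (J : Fin (k + l) → ℝ) (x : Phase k l) :
    Fin (k + l) ⊕ Fin 2 → (Phase k l →L[ℝ] ℝ) × ℝ :=
  Sum.elim (fun i => (fderiv ℝ (heisenbergIntegral k l c J i) x, 1))
    ![(fderiv ℝ (phiOne k l) x, 0), (fderiv ℝ (phiTwo k l) x, 0)]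

theorem continuous_regularityFamily : Continuous (regularityFamily (k := k) (l := l) c J) := by
  refine continuous_pi fun i => ?_
  have h1 := (contDiff_phiOne (k := k) (l := l) (n := 1)).continuous_fderiv (by norm_num)
  have h2 := (contDiff_phiTwo (k := k) (l := l) (n := 1)).continuous_fderiv (by norm_num)
  rcases i with i | i
  · exact ((contDiff_heisenbergIntegral (n := 1) c J i).continuous_fderiv (by norm_num)).prodMk
      continuous_const
  · fin_cases i
    · exact h1.prodMk continuous_const
    · exact h2.prodMk continuous_const

theorem linearIndependent_regularityFamily_iff {x : Phase k l} :
    LinearIndependent ℝ (regularityFamily c J x) ↔ ∀ (a : Fin (k + l) → ℝ) (s t : ℝ),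
      ∑ i, a i = 0 → (∑ i, a i • fderiv ℝ (heisenbergIntegral k l c J i) x) +
        s • fderiv ℝ (phiOne k l) x + t • fderiv ℝ (phiTwo k l) x = 0 →
      a = 0 ∧ s = 0 ∧ t = 0 := by
  rw [Fintype.linearIndependent_iff]
  constructor
  · intro h a s t ha hL
    have h1 := h (Sum.elim a ![s, t]) (by
      ext1
      · simpa [regularityFamily, Prod.fst_sum, add_assoc] using hL
      · simpa [regularityFamily, Prod.snd_sum] using ha)
    exact ⟨funext fun i => h1 (Sum.inl i), h1 (Sum.inr 0), h1 (Sum.inr 1)⟩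
  · intro h g hg
    have h1 := congrArg Prod.fst hg
    have h2 := congrArg Prod.snd hg
    simp [regularityFamily, Prod.fst_sum] at h1
    simp [regularityFamily, Prod.snd_sum] at h2
    obtain ⟨e1, e2, e3⟩ := h (fun i => g (Sum.inl i)) (g (Sum.inr 0)) (g (Sum.inr 1)) h2
      (by rw [← h1, add_assoc])
    rintro (i | i)
    · exact congrFun e1 i
    · fin_cases i
      · exact e2
      · exact e3

/-- The extra real coordinate of the family forces the coefficients to have sum zero. This removes
the known relation `∑ df_i = c dφ₁`, so regularity becomes linear independence, an open condition.
-/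
theorem regularSet_iff {x : Phase k l} (hx : x ∈ PStar k l c J) :
    x ∈ regularSet k l c J ↔ LinearIndependent ℝ (regularityFamily c J x) := by
  have hK := hx.2.2
  rw [linearIndependent_regularityFamily_iff]
  constructor
  · rintro ⟨-, h⟩ a s t ha hL
    have hconst := h a fun u hu => by
      have h1 := DFunLike.congr_fun hL u
      rw [mem_tangentSpaceP] at hu
      simpa [fderiv_phiOne, fderiv_phiTwo, hu] using h1
    have ha0 : a = 0 := by
      ext i
      have : ∑ j, a j = (k + l : ℝ) * a i := by
        rw [Finset.sum_congr rfl fun j _ => hconst j i]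
        simp
      rw [ha] at this
      have hn : (k + l : ℝ) ≠ 0 := by
        have := i.pos
        exact_mod_cast this.ne'
      simpa [hn] using this.symm
    refine ⟨ha0, ?_⟩
    have hli := linearIndependent_fderiv_phi hK
    rw [LinearIndependent.pair_iff] at hli
    exact hli s t (by simpa [ha0] using hL)
  · refine fun h => ⟨hx, fun a ha i j => ?_⟩
    have hn : (k + l : ℝ) ≠ 0 := by
      have := i.pos
      exact_mod_cast this.ne'
    -- Subtracting the mean normalizes the sum to zero and does not change the covector on the
    -- tangent space.
    set r := (∑ j, a j) / (k + l : ℝ) with hr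
    set L := ∑ i, (a i - r) • fderiv ℝ (heisenbergIntegral k l c J i) x with hL
    have hvan : ∀ u ∈ tangentSpaceP k l x, L u = 0 := by
      intro u hu
      have h1 := ha u hu
      have h2 := sum_fderiv_heisenbergIntegral (c := c) (J := J) x u
      rw [mem_tangentSpaceP] at hu
      rw [fderiv_phiOne, hu.1] at h2
      simp only [hL, sum_apply, smul_apply, smul_eq_mul, sub_mul, Finset.sum_sub_distrib,
        ← Finset.mul_sum, h1, h2]
      simp
    have h1 := eq_of_vanish_on_tangentSpaceP hK hvan
    have h2 := (h (fun i => a i - r) (-(L (normalOne J x) / (2 * kFun k l J x)))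
      (-(L (normalTwo J x) / (2 * kFun k l J x))) (by
        rw [Finset.sum_sub_distrib, hr]
        simp
        field_simp
        ring) (by
        rw [← hL]
        nth_rewrite 1 [h1]
        module)).1
    have e1 := congrFun h2 i
    have e2 := congrFun h2 j
    simp only [Pi.zero_apply] at e1 e2
    linarith

theorem exists_isOpen_regularSet :
    ∃ U : Set (Phase k l), IsOpen U ∧ regularSet k l c J = PStar k l c J ∩ U := by
  refine ⟨{x | LinearIndependent ℝ (regularityFamily c J x)},
    isOpen_setOfPred_linearIndependent.preimage continuous_regularityFamily, ?_⟩
  ext x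
  exact ⟨fun h => ⟨h.1, (regularSet_iff h.1).1 h⟩, fun h => (regularSet_iff h.1).2 h.2⟩

/-- A combination of the `df_i` vanishing on the tangent space is a combination of `dφ₁` and `dφ₂`.
Evaluation on `normalTwo` kills the coefficient of `dφ₂`, so all `Q`-derivatives vanish; these are
the equations of the hypothesis. -/
theorem mem_regularSet_of_momentCoeff (hJ : ∀ i, J i ≠ 0) {x : Phase k l}
    (hx : x ∈ PStar k l c J)
    (h : ∀ a : Fin (k + l) → ℝ, (∀ i, ∑ m, momentCoeff J x i m * x.1 m * (a m - a i) = 0) →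
      ∀ i j, a i = a j) : x ∈ regularSet k l c J := by
  refine ⟨hx, fun a ha => h a fun m => ?_⟩
  set L := ∑ i, a i • fderiv ℝ (heisenbergIntegral k l c J i) x with hL
  have hLa : ∀ u, L u = ∑ i, a i * fderiv ℝ (heisenbergIntegral k l c J i) x u := by
    intro u
    simp [hL]
  have h1 := eq_of_vanish_on_tangentSpaceP hx.2.2 (L := L) fun u hu => by rw [hLa, ha u hu]
  have h2 : L (normalTwo J x) = 0 := by
    rw [hLa]
    refine Finset.sum_eq_zero fun i _ => ?_
    have := poisson_phiOne_heisenbergIntegral hJ c i x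
    rw [poisson_phiOne] at this
    rw [(mul_eq_zero.1 this).resolve_left two_ne_zero, mul_zero]
  have h3 : L (0, Pi.single m 1) = 0 := by
    rw [h1, h2]
    simp [fderiv_phiOne, pseudoInner_zero_right]
  have h4 : L (0, Pi.single m 1) =
      2 * J m * ∑ i, momentCoeff J x m i * x.1 i * (a i - a m) := by
    rw [hLa]
    trans ∑ i, a i * dQ k l (heisenbergIntegral k l c J i) m x
    · rfl
    simp only [dQ_heisenbergIntegral, mul_add, Finset.sum_add_distrib, mul_ite, mul_zero,
      Finset.sum_ite_eq, Finset.mem_univ, if_true, mul_sub, Finset.sum_sub_distrib,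
      Finset.mul_sum]
    rw [sub_eq_add_neg, add_comm, ← Finset.sum_neg_distrib]
    congr 1
    · refine Finset.sum_congr rfl fun i _ => ?_
      rw [momentCoeff_symm x i m]
      ring
    · exact Finset.sum_congr rfl fun i _ => by ring
  rw [h4] at h3
  simpa [hJ m] using h3

/-! ### Density of the regular set. -/

theorem mem_closure_of_fst_ne_zero {x : Phase k l} (hx : x ∈ PStar k l c J) :
    x ∈ closure {y | y ∈ PStar k l c J ∧ ∀ i, y.1 i ≠ 0} := by
  obtain ⟨j, hj⟩ : ∃ j, x.1 j ≠ 0 := by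
    by_contra! h
    refine hx.2.2 ?_
    simp [kFun, pseudoInner, h]
  set m : ℝ := ∑ i, if x.1 i = 0 then tau k l i else 0 with hm
  -- Replacing the zero coordinates by `ε` adds `m * ε ^ 2` to `⟨q, q⟩`; the nonzero coordinate `j`
  -- is rescaled to compensate.
  set g : ℝ → Phase k l := fun ε => (fun i => if x.1 i = 0 then ε else
    if i = j then x.1 j * √(1 - tau k l j * m * ε ^ 2 / x.1 j ^ 2) else x.1 i, x.2) with hg
  have hcont : Continuous g := by
    refine Continuous.prodMk (continuous_pi fun i => ?_) continuous_const
    split_ifs <;> fun_prop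
  have hg0 : g 0 = x := by
    ext i
    · simp only [hg]
      split_ifs with h1 h2
      · exact h1.symm
      · simp [h2]
      · rfl
    · rfl
  have ht : Filter.Tendsto g (nhdsWithin 0 {0}ᶜ) (nhds x) := by
    have := hcont.tendsto 0
    rw [hg0] at this
    exact this.mono_left nhdsWithin_le_nhds
  refine mem_closure_of_tendsto ht ?_
  have hpos : ∀ᶠ ε : ℝ in nhds 0, 0 < 1 - tau k l j * m * ε ^ 2 / x.1 j ^ 2 := by
    have : Continuous fun ε : ℝ => 1 - tau k l j * m * ε ^ 2 / x.1 j ^ 2 := by fun_prop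
    exact this.continuousAt.eventually (lt_mem_nhds (by simp))
  have hKev : ∀ᶠ ε : ℝ in nhds 0, kFun k l J (g ε) ≠ 0 := by
    have : Continuous fun ε => kFun k l J (g ε) :=
      (contDiff_kFun (n := 0) J).continuous.comp hcont
    exact this.continuousAt.eventually_ne (by rw [hg0]; exact hx.2.2)
  filter_upwards [hpos.filter_mono nhdsWithin_le_nhds, hKev.filter_mono nhdsWithin_le_nhds,
    self_mem_nhdsWithin] with ε h1 h2 h3
  refine ⟨⟨?_, hx.2.1, h2⟩, fun i => ?_⟩
  · have hx1 := hx.1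
    have key : phiOne k l (g ε) = phiOne k l x +
        (∑ i, (if x.1 i = 0 then tau k l i else 0) * ε ^ 2) -
        ∑ i, if i = j then m * ε ^ 2 else 0 := by
      simp only [phiOne, pseudoInner, ← Finset.sum_add_distrib, ← Finset.sum_sub_distrib]
      refine Finset.sum_congr rfl fun i _ => ?_
      simp only [hg]
      rcases eq_or_ne i j with rfl | hij
      · simp only [hj, if_false, if_true]
        have hs := Real.mul_self_sqrt h1.le
        have ht := tau_mul_self (k := k) (l := l) i
        calc _ = tau k l i * x.1 i ^ 2 * (√(1 - tau k l i * m * ε ^ 2 / x.1 i ^ 2) *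
              √(1 - tau k l i * m * ε ^ 2 / x.1 i ^ 2)) := by ring
          _ = tau k l i * x.1 i ^ 2 - tau k l i * tau k l i * m * ε ^ 2 := by
            rw [hs]; field_simp
          _ = _ := by rw [ht]; ring
      · by_cases hi : x.1 i = 0
        · simp [hi, hij]; ring
        · simp [hi, hij]
    rw [key, hx1, ← Finset.sum_mul, ← hm]
    simp
  · simp only [hg]
    split_ifs with h4 h5
    · exact h3
    · exact mul_ne_zero hj (Real.sqrt_pos.2 h1).ne'
    · exact h4

/-- The shift along `J⁻¹q` is invisible to `q ∧ p`, so it is free for restoring `⟨Q, Q⟩ = c`. -/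
theorem momentCoeff_add_normal (hJ : ∀ i, J i ≠ 0) (q Q e : Fin (k + l) → ℝ) (t s : ℝ)
    (i m : Fin (k + l)) :
    momentCoeff J ((q, fun i => Q i + t * e i + s * ((J i)⁻¹ * q i)) : Phase k l) i m =
      momentCoeff J ((q, Q) : Phase k l) i m + t * momentCoeff J ((q, e) : Phase k l) i m := by
  have h1 := mul_inv_cancel₀ (hJ i)
  have h2 := mul_inv_cancel₀ (hJ m)
  simp only [momentCoeff, div_eq_mul_inv]
  linear_combination tau k l i * tau k l m * (J i ^ 2 - J m ^ 2)⁻¹ * s * q i * q m * (h2 - h1)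

/-- Perturbing `Q` by a coordinate vector makes a point regular, but for finitely many
parameters. -/
theorem eventually_momentCoeff_regular (hJ : ∀ i, J i ≠ 0)
    (hJJ : ∀ i j, i ≠ j → J i ^ 2 ≠ J j ^ 2) {q : Fin (k + l) → ℝ} (hq : ∀ i, q i ≠ 0)
    (Q : Fin (k + l) → ℝ) (α : Fin (k + l)) :
    ∀ᶠ t : ℝ in nhdsWithin 0 {0}ᶜ, ∀ a : Fin (k + l) → ℝ,
      (∀ i, ∑ m, (momentCoeff J ((q, Q) : Phase k l) i m +
        t * momentCoeff J ((q, Pi.single α 1) : Phase k l) i m) * q m * (a m - a i) = 0) →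
      ∀ i j, a i = a j := by
  set y := momentCoeff J ((q, Q) : Phase k l) with hy
  set y' := momentCoeff J ((q, Pi.single α 1) : Phase k l) with hy'
  set w : Fin (k + l) → ℝ := fun i => y' i α * q α with hw
  -- The perturbation `y'` links only `α` to the other indices. After normalizing `a` to vanish at
  -- `α`, the `i`-th equation divided by `w i` reads `T b i = t * b i`. At `i = α` division by `w α
  -- = 0` gives `0`, in agreement with `b α = 0`.
  set T : (Fin (k + l) → ℝ) →ₗ[ℝ] (Fin (k + l) → ℝ) := LinearMap.pi fun i =>
    ∑ m, (y i m * q m / w i) • ((LinearMap.proj m : (Fin (k + l) → ℝ) →ₗ[ℝ] ℝ) - LinearMap.proj i) with hT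
  have hTa : ∀ b i, T b i = (∑ m, y i m * q m * (b m - b i)) / w i := by
    intro b i
    simp only [hT, LinearMap.pi_apply, LinearMap.sum_apply, LinearMap.smul_apply,
      LinearMap.sub_apply, LinearMap.proj_apply, smul_eq_mul, Finset.sum_div]
    exact Finset.sum_congr rfl fun m _ => by ring
  have hwα : w α = 0 := by simp [hw, hy', momentCoeff_self]
  have hwi : ∀ i, i ≠ α → w i ≠ 0 := by
    intro i hi
    have := sub_ne_zero.2 (hJJ i α hi)
    simp [hw, hy', momentCoeff, hi, tau_ne_zero, hJ, hq, this]
  have hy0 : ∀ i m, i ≠ α → m ≠ α → y' i m = 0 := by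
    intro i m hi hm
    simp [hy', momentCoeff, hi, hm]
  have hfin : ({μ | Module.End.HasEigenvalue T μ} : Set ℝ).Finite := Module.End.finite_hasEigenvalue T
  have hev : ∀ᶠ t : ℝ in nhdsWithin 0 {0}ᶜ, ¬ Module.End.HasEigenvalue T t := by
    -- Constant vectors lie in the kernel of `T`, so `0` is an eigenvalue and has to be set aside.
    have h1 : ({μ | Module.End.HasEigenvalue T μ} \ {0} : Set ℝ)ᶜ ∈ nhds (0 : ℝ) :=
      (hfin.subset Set.sdiff_subset).isClosed.isOpen_compl.mem_nhds (by simp)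
    filter_upwards [mem_nhdsWithin_of_mem_nhds h1, self_mem_nhdsWithin] with t h2 h3 h4
    exact h2 ⟨h4, h3⟩
  filter_upwards [hev] with t ht a ha
  set b : Fin (k + l) → ℝ := fun i => a i - a α with hb
  have hTb : T b = t • b := by
    ext i
    rw [hTa]
    rcases eq_or_ne i α with rfl | hi
    · simp [hwα, hb]
    · have h1 := ha i
      have h2 : ∑ m, t * y' i m * q m * (a m - a i) = -(t * w i * b i) := by
        rw [Finset.sum_eq_single α (fun m _ hm => by rw [hy0 i m hi hm]; ring) (by simp)]
        simp only [hw, hb]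
        ring
      simp only [add_mul, Finset.sum_add_distrib] at h1
      rw [h2] at h1
      have h3 : ∑ m, y i m * q m * (b m - b i) = ∑ m, y i m * q m * (a m - a i) :=
        Finset.sum_congr rfl fun m _ => by simp only [hb]; ring
      rw [h3, div_eq_iff (hwi i hi), Pi.smul_apply, smul_eq_mul]
      linarith
  have hb0 : b = 0 := by
    by_contra hne
    exact ht (Module.End.hasEigenvalue_of_hasEigenvector
      (Module.End.hasEigenvector_iff.2 ⟨Module.End.mem_eigenspace_iff.2 hTb, hne⟩))
  intro i j
  have h1 := congrFun hb0 i
  have h2 := congrFun hb0 j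
  simp only [hb, Pi.zero_apply] at h1 h2
  linarith

theorem mem_closure_regularSet_of_fst_ne_zero (hJ : ∀ i, J i ≠ 0)
    (hJJ : ∀ i j, i ≠ j → J i ^ 2 ≠ J j ^ 2) {x : Phase k l} (hx : x ∈ PStar k l c J)
    (hq : ∀ i, x.1 i ≠ 0) : x ∈ closure (regularSet k l c J) := by
  have hK := hx.2.2
  obtain ⟨α⟩ : Nonempty (Fin (k + l)) := by
    by_contra h
    rw [not_nonempty_iff] at h
    exact hK (by simp [kFun, pseudoInner])
  set e : Fin (k + l) → ℝ := Pi.single α 1 with he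
  set w : Fin (k + l) → ℝ := fun i => (J i)⁻¹ * x.1 i with hw
  set A := pseudoInner k l w w with hA
  set b : ℝ → ℝ := fun t => kFun k l J x + t * pseudoInner k l e w with hb
  set d : ℝ → ℝ := fun t => 2 * t * pseudoInner k l x.2 e + t ^ 2 * pseudoInner k l e e with hd
  -- `s` is to solve `A s² + 2 b s + d = 0`, the condition that `⟨Q, Q⟩` is unchanged. The root `-d
  -- / (b + r)` tends to `0` and makes sense also for `A = 0`; giving `r` the sign of `K` makes `b +
  -- r` tend to `2K ≠ 0`.
  set r : ℝ → ℝ := fun t => kFun k l J x * √((b t ^ 2 - A * d t) / kFun k l J x ^ 2) with hr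
  set s : ℝ → ℝ := fun t => -d t / (b t + r t) with hs
  set g : ℝ → Phase k l := fun t => (x.1, fun i => x.2 i + t * e i + s t * w i) with hg
  have hbc : Continuous b := by fun_prop
  have hdc : Continuous d := by fun_prop
  have hrc : Continuous r := by fun_prop
  have hd0 : d 0 = 0 := by simp [hd]
  have hb0 : b 0 = kFun k l J x := by simp [hb]
  have hr0 : r 0 = kFun k l J x := by simp [hr, hd0, hb0, hK]
  have hbr0 : b 0 + r 0 ≠ 0 := by rw [hb0, hr0, ← two_mul]; exact mul_ne_zero two_ne_zero hK
  have hs0 : s 0 = 0 := by simp [hs, hd0]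
  have hsc : ContinuousAt s 0 := hdc.neg.continuousAt.div (hbc.add hrc).continuousAt hbr0
  have hgc : ContinuousAt g 0 := by
    refine ContinuousAt.prodMk continuousAt_const (continuousAt_pi.2 fun i => ?_)
    exact (continuousAt_const.add (continuousAt_id.mul continuousAt_const)).add
      (hsc.mul continuousAt_const)
  have hg0 : g 0 = x := by
    ext i <;> simp [hg, hs0]
  have ht : Filter.Tendsto g (nhdsWithin 0 {0}ᶜ) (nhds x) := by
    have := hgc.tendsto
    rw [hg0] at this
    exact this.mono_left nhdsWithin_le_nhds
  refine mem_closure_of_tendsto ht ?_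
  have hpos : ∀ᶠ t : ℝ in nhds 0, 0 < (b t ^ 2 - A * d t) / kFun k l J x ^ 2 := by
    have : Continuous fun t => (b t ^ 2 - A * d t) / kFun k l J x ^ 2 := by fun_prop
    exact this.continuousAt.eventually (lt_mem_nhds (by simp [hd0, hb0, hK]))
  have hbr : ∀ᶠ t : ℝ in nhds 0, b t + r t ≠ 0 :=
    (hbc.add hrc).continuousAt.eventually_ne hbr0
  have hKev : ∀ᶠ t : ℝ in nhds 0, kFun k l J (g t) ≠ 0 := by
    have : ContinuousAt (fun t => kFun k l J (g t)) 0 :=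
      (contDiff_kFun (n := 0) J).continuous.continuousAt.comp hgc
    exact this.eventually_ne (by rw [hg0]; exact hK)
  filter_upwards [hpos.filter_mono nhdsWithin_le_nhds, hbr.filter_mono nhdsWithin_le_nhds,
    hKev.filter_mono nhdsWithin_le_nhds, eventually_momentCoeff_regular hJ hJJ hq x.2 α]
    with t h1 h2 h3 h4
  refine mem_regularSet_of_momentCoeff hJ ⟨hx.1, ?_, h3⟩ fun a ha => h4 a fun i => ?_
  · have key : phiTwo k l (g t) = phiTwo k l x + (A * s t ^ 2 + 2 * b t * s t + d t) := by
      have hk : kFun k l J x = pseudoInner k l x.2 w := (pseudoInner_normalTwo J x).symm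
      simp only [hb, hd, hA, hk, phiTwo, hg, pseudoInner, Finset.mul_sum, Finset.sum_mul, mul_add,
        add_mul, ← Finset.sum_add_distrib]
      exact Finset.sum_congr rfl fun i _ => by ring
    have hr2 : r t ^ 2 = b t ^ 2 - A * d t := by
      simp only [hr, mul_pow, Real.sq_sqrt h1.le]
      field_simp
    have hzero : A * s t ^ 2 + 2 * b t * s t + d t = 0 := by
      simp only [hs]
      field_simp
      linear_combination d t * hr2
    rw [key, hzero, add_zero]
    exact hx.2.1
  · rw [← ha i]
    refine Finset.sum_congr rfl fun m _ => ?_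
    rw [← momentCoeff_add_normal hJ x.1 x.2 e t (s t)]

theorem PStar_subset_closure_regularSet (hJ : ∀ i, J i ≠ 0)
    (hJJ : ∀ i j, i ≠ j → J i ^ 2 ≠ J j ^ 2) :
    PStar k l c J ⊆ closure (regularSet k l c J) := fun _ hx =>
  closure_minimal (fun _ hy => mem_closure_regularSet_of_fst_ne_zero hJ hJJ hy.1 hy.2)
    isClosed_closure (mem_closure_of_fst_ne_zero hx)

end Regular

theorem theorem3 (k l : ℕ) (c : ℝ) (hc : c = 1 ∨ c = -1 ∨ c = 0)
    (J : Fin (k + l) → ℝ) (hJ : ∀ i, J i ≠ 0) (hJJ : ∀ i j, i ≠ j → J i ^ 2 ≠ J j ^ 2) :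
    -- `(P_c^*, Ω)` is a symplectic submanifold of dimension `2 (n - 1)`, `n = k + l`
    (∀ x ∈ PStar k l c J,
      LinearIndependent ℝ ![fderiv ℝ (phiOne k l) x, fderiv ℝ (phiTwo k l) x] ∧
      Module.finrank ℝ (tangentSpaceP k l x) + 2 = 2 * (k + l) ∧
      (∀ u ∈ tangentSpaceP k l x, (∀ v ∈ tangentSpaceP k l x, Omega k l J u v = 0) → u = 0)) ∧
    -- the Dirac bracket is the Poisson bracket of `(P_c^*, Ω)`: `{f, g} = df (X_g)`, where
    -- `X_g` is the Hamiltonian vector of `g`, that is `Ω (X_g, v) = - dg (v)`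
    (∀ x ∈ PStar k l c J, ∀ f g : Phase k l → ℝ,
      DifferentiableAt ℝ f x → DifferentiableAt ℝ g x →
      ∃ X : Phase k l, X ∈ tangentSpaceP k l x ∧
        (∀ v ∈ tangentSpaceP k l x, Omega k l J X v = - fderiv ℝ g x v) ∧
        diracBracket k l J f g x = fderiv ℝ f x X) ∧
    -- the map preserves `P_c^*` and is symplectic
    (∀ x ∈ PStarDom k l c J,
      ContDiffAt ℝ ((⊤ : ℕ∞) : WithTop ℕ∞) (heisenbergMap k l J) x ∧
      heisenbergMap k l J x ∈ PStar k l c J ∧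
      (∀ u ∈ tangentSpaceP k l x,
        fderiv ℝ (heisenbergMap k l J) x u ∈ tangentSpaceP k l (heisenbergMap k l J x)) ∧
      (∀ u ∈ tangentSpaceP k l x, ∀ v ∈ tangentSpaceP k l x,
        Omega k l J (fderiv ℝ (heisenbergMap k l J) x u) (fderiv ℝ (heisenbergMap k l J) x v) =
          Omega k l J u v)) ∧
    -- the functions `f_i` are the coefficients of the characteristic polynomial of the Lax matrix
    (∀ x ∈ PStar k l c J, ∀ z m : ℂ,
      (m • (1 : Matrix (Fin (k + l)) (Fin (k + l)) ℂ) - laxMatrix k l c J x z).det =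
        ∏ i, (m - (J i : ℂ) ^ 2) +
          z ^ 2 * ∑ i, (heisenbergIntegral k l c J i x : ℂ) *
            ∏ j ∈ Finset.univ.erase i, (m - (J j : ℂ) ^ 2)) ∧
    -- they are first integrals
    (∀ x ∈ PStarDom k l c J, ∀ i,
      heisenbergIntegral k l c J i (heisenbergMap k l J x) = heisenbergIntegral k l c J i x) ∧
    -- they commute
    (∀ x ∈ PStar k l c J, ∀ i j,
      diracBracket k l J (heisenbergIntegral k l c J i) (heisenbergIntegral k l c J j) x = 0) ∧
    -- they satisfy one relation
    (∀ x ∈ PStar k l c J, ∑ i, heisenbergIntegral k l c J i x = c ^ 2) ∧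
    -- and no other one: on an open dense subset of `P_c^*`, their differentials have rank `n - 1`
    ((∃ U : Set (Phase k l), IsOpen U ∧ regularSet k l c J = PStar k l c J ∩ U) ∧
      PStar k l c J ⊆ closure (regularSet k l c J)) := by
  refine ⟨fun x hx => ⟨linearIndependent_fderiv_phi hx.2.2, finrank_tangentSpaceP hx.2.2,
      fun u hu h => Omega_nondegenerate hJ hx.2.2 hu h⟩, fun x hx f g _ _ =>
      ⟨tangentProj J x (hamVector J g x), tangentProj_mem hx.2.2 _, fun v hv => ?_,
        diracBracket_eq_fderiv x hx.2.2 f g⟩,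
    fun x hx => ⟨contDiffAt_heisenbergMap hx.2, heisenbergMap_mem hx,
      fun u hu => fderiv_heisenbergMap_mem hx.2 hu,
      fun u hu v hv => Omega_fderiv_heisenbergMap hJ hx.2 hu hv⟩,
    fun x _ z m => det_sub_laxMatrix hJJ c x z m,
    fun x hx i => heisenbergIntegral_heisenbergMap hJ hJJ hx.1 i,
    fun x _ i j => diracBracket_heisenbergIntegral hJ hJJ c i j x, fun x hx => ?_,
    exists_isOpen_regularSet, PStar_subset_closure_regularSet hJ hJJ⟩
  · rw [Omega_tangentProj hJ x _ hv, Omega_hamVector hJ]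
  · rw [sum_heisenbergIntegral, hx.1, sq]
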